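/- \textbf{Theorem (Disjunction Property of $\mathsf{L_{RBL}}$).} Fix a set $\mathsf{Prop}$ of propositional letters. Formulas are given by $$A ::= p \mid \bot \mid \top \mid A\wedge A \mid A\vee A \mid A\cdot A \mid A\to A \mid A\leftarrow A \qquad (p\in\mathsf{Prop}).$$ Formula structures are given by: every formula is a structure, and if $\Gamma,\Delta$ are structures, then so are $\Gamma\odot\Delta$ and $\Gamma\barwedge\Delta$ (there is no empty structure). $\Gamma[-]$ denotes a structure with one hole (possibly the bare hole), and $\Gamma[\Delta]$ the result of putting $\Delta$ into the hole. Sequents have the form $\Gamma\Rightarrow A$ with $\Gamma$ a structure and $A$ a formula. The calculus $\mathsf{L_{RBL}}$ has the axioms $A\Rightarrow A$, $A\Rightarrow\top$, $\bot\Rightarrow A$, and the following rules (premises before the slash, conclusion after it): - $(\to\mathrm L)$ $\Delta\Rightarrow A,\ \Gamma[B]\Rightarrow C\ /\ \Gamma[\Delta\odot(A\to B)]\Rightarrow C$; $(\to\mathrm R)$ $A\odot\Gamma\Rightarrow B\ /\ \Gamma\Rightarrow A\to B$; - $(\leftarrow\mathrm L)$ $\Gamma[A]\Rightarrow C,\ \Delta\Rightarrow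 B\ /\ \Gamma[(A\leftarrow B)\odot\Delta]\Rightarrow C$; $(\leftarrow\mathrm R)$ $\Gamma\odot B\Rightarrow A\ /\ \Gamma\Rightarrow A\leftarrow B$; - $(\cdot\mathrm L)$ $\Gamma[A\odot B]\Rightarrow C\ /\ \Gamma[A\cdot B]\Rightarrow C$; $(\cdot\mathrm R)$ $\Gamma\Rightarrow A,\ \Delta\Rightarrow B\ /\ \Gamma\odot\Delta\Rightarrow A\cdot B$; - $(\wedge\mathrm L)$ $\Gamma[A\barwedge B]\Rightarrow C\ /\ \Gamma[A\wedge B]\Rightarrow C$; $(\wedge\mathrm R)$ $\Gamma\Rightarrow A,\ \Gamma\Rightarrow B\ /\ \Gamma\Rightarrow A\wedge B$; - $(\vee\mathrm L)$ $\Gamma[A]\Rightarrow C,\ \Gamma[B]\Rightarrow C\ /\ \Gamma[A\vee B]\Rightarrow C$; $(\vee\mathrm R)$ $\Gamma\Rightarrow A_i\ /\ \Gamma\Rightarrow A_1\vee A_2$ for $i=1,2$; - contraction: $\Gamma[\Delta\barwedge\Delta]\Rightarrow A\ /\ \Gamma[\Delta]\Rightarrow A$ and $\Gamma[(\Lambda\odot\Delta)\odot\Delta]\Rightarrow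 A\ /\ \Gamma[\Lambda\odot\Delta]\Rightarrow A$; - exchange: $\Gamma[\Delta\barwedge\Lambda]\Rightarrow A\ /\ \Gamma[\Lambda\barwedge\Delta]\Rightarrow A$; - weakening, for $*\in\{\barwedge,\odot\}$: $\Gamma[\Delta]\Rightarrow A\ /\ \Gamma[\Delta'*\Delta]\Rightarrow A$ and $\Gamma[\Delta]\Rightarrow A\ /\ \Gamma[\Delta*\Delta']\Rightarrow A$; - associativity, in both directions: $\Gamma[(\Delta_1\barwedge\Delta_2)\barwedge\Delta_3]\Rightarrow A\ /\ \Gamma[\Delta_1\barwedge(\Delta_2\barwedge\Delta_3)]\Rightarrow A$ and conversely; - $(\mathrm{Cut})$ $\Delta\Rightarrow A,\ \Gamma[A]\Rightarrow B\ /\ \Gamma[\Delta]\Rightarrow B$. Then for all formulas $A$ and $B$: if $\top\Rightarrow A\vee B$ is derivable in $\mathsf{L_{RBL}}$, then $\top\Rightarrow A$ is derivable in $\mathsf{L_{RBL}}$ or $\top\Rightarrow B$ is derivable in $\mathsf{L_{RBL}}$. -/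

import Mathlib

namespace RBL

/-- Formulas of the language of residuated basic logic over a type `α` of propositional letters. -/
inductive Formula (α : Type*) where
  /-- a propositional letter -/
  | var (p : α)
  /-- `⊥` -/
  | bot
  /-- `⊤` -/
  | top
  /-- `A ∧ B` -/
  | and (A B : Formula α)
  /-- `A ∨ B` -/
  | or (A B : Formula α)
  /-- the product `A · B` -/
  | prod (A B : Formula α)
  /-- `A → B` -/
  | imp (A B : Formula α)
  /-- `A ← B` -/
  | coimp (A B : Formula α)

/-- Formula structures: built from formulas with the two structural operations `⊙` and `⩕`.
There is no empty structure. -/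
inductive FStruct (α : Type*) where
  /-- a formula, as a structure -/
  | of (A : Formula α)
  /-- `Γ ⊙ Δ` -/
  | odot (Γ Δ : FStruct α)
  /-- `Γ ⩕ Δ` -/
  | owedge (Γ Δ : FStruct α)

/-- Contexts `Γ[-]`: formula structures with exactly one hole. -/
inductive Ctx (α : Type*) where
  /-- the trivial context `[-]` -/
  | hole
  /-- `Γ[-] ⊙ Δ` -/
  | odotL (Γ : Ctx α) (Δ : FStruct α)
  /-- `Δ ⊙ Γ[-]` -/
  | odotR (Δ : FStruct α) (Γ : Ctx α)
  /-- `Γ[-] ⩕ Δ` -/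
  | owedgeL (Γ : Ctx α) (Δ : FStruct α)
  /-- `Δ ⩕ Γ[-]` -/
  | owedgeR (Δ : FStruct α) (Γ : Ctx α)

/-- `Γ.fill Θ` is the structure `Γ[Θ]`. -/
def Ctx.fill {α : Type*} : Ctx α → FStruct α → FStruct α
  | .hole, Θ => Θ
  | .odotL Γ Δ, Θ => .odot (Γ.fill Θ) Δ
  | .odotR Δ Γ, Θ => .odot Δ (Γ.fill Θ)
  | .owedgeL Γ Δ, Θ => .owedge (Γ.fill Θ) Δ
  | .owedgeR Δ Γ, Θ => .owedge Δ (Γ.fill Θ)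

/-- `LRBL Γ A`: the sequent `Γ ⇒ A` is derivable in the sequent calculus `L_RBL` (with cut).
The provisos of `impR`, `coimpR` and `odotC`, that a structure be non-empty, hold automatically. -/
inductive LRBL {α : Type*} : FStruct α → Formula α → Prop where
  /-- (Id) -/
  | id (A : Formula α) : LRBL (.of A) A
  /-- (⊤) -/
  | top (A : Formula α) : LRBL (.of A) .top
  /-- (⊥) -/
  | bot (A : Formula α) : LRBL (.of .bot) A
  /-- (→L) -/
  | impL (Γ : Ctx α) (Δ : FStruct α) (A B C : Formula α) :
      LRBL Δ A → LRBL (Γ.fill (.of B)) C → LRBL (Γ.fill (.odot Δ (.of (.imp A B)))) C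
  /-- (→R) -/
  | impR (Γ : FStruct α) (A B : Formula α) : LRBL (.odot (.of A) Γ) B → LRBL Γ (.imp A B)
  /-- (←L) -/
  | coimpL (Γ : Ctx α) (Δ : FStruct α) (A B C : Formula α) :
      LRBL (Γ.fill (.of A)) C → LRBL Δ B → LRBL (Γ.fill (.odot (.of (.coimp A B)) Δ)) C
  /-- (←R) -/
  | coimpR (Γ : FStruct α) (A B : Formula α) : LRBL (.odot Γ (.of B)) A → LRBL Γ (.coimp A B)
  /-- (·L) -/
  | prodL (Γ : Ctx α) (A B C : Formula α) :
      LRBL (Γ.fill (.odot (.of A) (.of B))) C → LRBL (Γ.fill (.of (.prod A B))) C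
  /-- (·R) -/
  | prodR (Γ Δ : FStruct α) (A B : Formula α) :
      LRBL Γ A → LRBL Δ B → LRBL (.odot Γ Δ) (.prod A B)
  /-- (∧L) -/
  | andL (Γ : Ctx α) (A B C : Formula α) :
      LRBL (Γ.fill (.owedge (.of A) (.of B))) C → LRBL (Γ.fill (.of (.and A B))) C
  /-- (∧R) -/
  | andR (Γ : FStruct α) (A B : Formula α) : LRBL Γ A → LRBL Γ B → LRBL Γ (.and A B)
  /-- (∨L) -/
  | orL (Γ : Ctx α) (A B C : Formula α) :
      LRBL (Γ.fill (.of A)) C → LRBL (Γ.fill (.of B)) C → LRBL (Γ.fill (.of (.or A B))) C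
  /-- (∨R), `i = 1` -/
  | orR₁ (Γ : FStruct α) (A B : Formula α) : LRBL Γ A → LRBL Γ (.or A B)
  /-- (∨R), `i = 2` -/
  | orR₂ (Γ : FStruct α) (A B : Formula α) : LRBL Γ B → LRBL Γ (.or A B)
  /-- (⩕C) -/
  | owedgeC (Γ : Ctx α) (Δ : FStruct α) (A : Formula α) :
      LRBL (Γ.fill (.owedge Δ Δ)) A → LRBL (Γ.fill Δ) A
  /-- (⊙C), the restricted contraction -/
  | odotC (Γ : Ctx α) (Θ Δ : FStruct α) (A : Formula α) :
      LRBL (Γ.fill (.odot (.odot Θ Δ) Δ)) A → LRBL (Γ.fill (.odot Θ Δ)) A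
  /-- (⩕E) -/
  | owedgeE (Γ : Ctx α) (Δ Θ : FStruct α) (A : Formula α) :
      LRBL (Γ.fill (.owedge Δ Θ)) A → LRBL (Γ.fill (.owedge Θ Δ)) A
  /-- (Cut) -/
  | cut (Γ : Ctx α) (Δ : FStruct α) (A B : Formula α) :
      LRBL Δ A → LRBL (Γ.fill (.of A)) B → LRBL (Γ.fill Δ) B
  /-- (W¹) for `⩕` -/
  | owedgeW₁ (Γ : Ctx α) (Δ Δ' : FStruct α) (A : Formula α) :
      LRBL (Γ.fill Δ) A → LRBL (Γ.fill (.owedge Δ' Δ)) A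
  /-- (W¹) for `⊙` -/
  | odotW₁ (Γ : Ctx α) (Δ Δ' : FStruct α) (A : Formula α) :
      LRBL (Γ.fill Δ) A → LRBL (Γ.fill (.odot Δ' Δ)) A
  /-- (W²) for `⩕` -/
  | owedgeW₂ (Γ : Ctx α) (Δ Δ' : FStruct α) (A : Formula α) :
      LRBL (Γ.fill Δ) A → LRBL (Γ.fill (.owedge Δ Δ')) A
  /-- (W²) for `⊙` -/
  | odotW₂ (Γ : Ctx α) (Δ Δ' : FStruct α) (A : Formula α) :
      LRBL (Γ.fill Δ) A → LRBL (Γ.fill (.odot Δ Δ')) A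
  /-- (⩕A¹) -/
  | owedgeA₁ (Γ : Ctx α) (Δ₁ Δ₂ Δ₃ : FStruct α) (A : Formula α) :
      LRBL (Γ.fill (.owedge (.owedge Δ₁ Δ₂) Δ₃)) A → LRBL (Γ.fill (.owedge Δ₁ (.owedge Δ₂ Δ₃))) A
  /-- (⩕A²) -/
  | owedgeA₂ (Γ : Ctx α) (Δ₁ Δ₂ Δ₃ : FStruct α) (A : Formula α) :
      LRBL (Γ.fill (.owedge Δ₁ (.owedge Δ₂ Δ₃))) A → LRBL (Γ.fill (.owedge (.owedge Δ₁ Δ₂) Δ₃)) A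

end RBL

namespace RBL

/-! This is a slash argument in the style of Kleene and Aczel. `Slash` is a predicate on formulas
that implies derivability from `⊤`, is prime on disjunctions by definition, and is inherited by the
succedent of a derivable sequent with slashed antecedent (`LRBL.slash`). Since `⊤` is slashed, the
theorem follows. No structure `Γ ⊙ Δ` is slashed, so the rules displaying `⊙` on the left of their
conclusion are harmless. Hence implications need no clause relating the slashes of their two sides:
derivability from `⊤` suffices, and soundness is proved by induction with cut kept as a rule. -/

variable {α : Type*}

/-- Composition of contexts. -/
def Ctx.comp : Ctx α → Ctx α → Ctx α
  | .hole, K => K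
  | .odotL Γ Δ, K => .odotL (Γ.comp K) Δ
  | .odotR Δ Γ, K => .odotR Δ (Γ.comp K)
  | .owedgeL Γ Δ, K => .owedgeL (Γ.comp K) Δ
  | .owedgeR Δ Γ, K => .owedgeR Δ (Γ.comp K)

theorem Ctx.fill_comp (Γ K : Ctx α) (Θ : FStruct α) :
    (Γ.comp K).fill Θ = Γ.fill (K.fill Θ) := by
  induction Γ <;> simp_all [Ctx.comp, Ctx.fill]

/-- The slash of a formula. Algebraically: evaluating in the Lindenbaum algebra extended by a new
top element `∞`, with every product computed in the old algebra, the formula takes the value `∞`. -/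
def Formula.Slash : Formula α → Prop
  | .var _ => False
  | .bot => False
  | .top => True
  | .and A B => A.Slash ∧ B.Slash
  | .or A B => A.Slash ∨ B.Slash
  | .prod _ _ => False
  | .imp A B => LRBL (.of .top) (.imp A B)
  | .coimp A B => LRBL (.of .top) (.coimp A B)

/-- The slash of a formula structure. -/
def FStruct.Slash : FStruct α → Prop
  | .of A => A.Slash
  | .odot _ _ => False
  | .owedge Γ Δ => Γ.Slash ∧ Δ.Slash

theorem Formula.Slash.derivable {A : Formula α} (h : A.Slash) : LRBL (.of .top) A := by
  induction A with
  | var | bot | prod => exact h.elim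
  | top => exact .id _
  | and A B ihA ihB => exact .andR _ _ _ (ihA h.1) (ihB h.2)
  | or A B ihA ihB => exact h.elim (fun h => .orR₁ _ _ _ (ihA h)) (fun h => .orR₂ _ _ _ (ihB h))
  | imp | coimp => exact h

/-- A slashed structure may be replaced by `⊤` in any context. -/
theorem FStruct.Slash.fill_top {Δ : FStruct α} (h : Δ.Slash) (Γ : Ctx α) {A : Formula α}
    (d : LRBL (Γ.fill Δ) A) : LRBL (Γ.fill (.of .top)) A := by
  induction Δ generalizing Γ with
  | of B => exact .cut Γ _ B A (Formula.Slash.derivable h) d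
  | odot => exact h.elim
  | owedge Δ Θ ihΔ ihΘ =>
    have d₁ := ihΔ h.1 (Γ.comp (.owedgeL .hole Θ)) (by rwa [Ctx.fill_comp])
    rw [Ctx.fill_comp] at d₁
    have d₂ := ihΘ h.2 (Γ.comp (.owedgeR (.of .top) .hole)) (by rwa [Ctx.fill_comp])
    rw [Ctx.fill_comp] at d₂
    -- Both components have become `⊤`, and contraction merges `⊤ ⩕ ⊤` into `⊤`.
    exact .owedgeC Γ _ A d₂

theorem FStruct.Slash.derivable_top {Γ : FStruct α} (h : Γ.Slash) {A : Formula α}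
    (d : LRBL Γ A) : LRBL (.of .top) A :=
  h.fill_top .hole d

/-- Reduces each left rule to a check at the hole: slash is a conjunction along `⩕`, and a hole
below `⊙` makes the hypothesis `s` absurd. -/
theorem FStruct.Slash.fill_mono (Γ : Ctx α) {Δ Θ : FStruct α}
    (s : (Γ.fill Δ).Slash) (h : Δ.Slash → Θ.Slash) : (Γ.fill Θ).Slash := by
  induction Γ with
  | hole => exact h s
  | odotL | odotR => exact s.elim
  | owedgeL Γ _ ih => exact ⟨ih s.1, s.2⟩
  | owedgeR _ Γ ih => exact ⟨s.1, ih s.2⟩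

/-- Primeness at the hole lifts through `⩕`, since the sibling structures stay slashed. -/
theorem FStruct.Slash.fill_or (Γ : Ctx α) {A B : Formula α}
    (s : (Γ.fill (.of (.or A B))).Slash) :
    (Γ.fill (.of A)).Slash ∨ (Γ.fill (.of B)).Slash := by
  induction Γ with
  | hole => exact s
  | odotL | odotR => exact s.elim
  | owedgeL Γ _ ih => exact (ih s.1).imp (fun h => ⟨h, s.2⟩) (fun h => ⟨h, s.2⟩)
  | owedgeR _ Γ ih => exact (ih s.2).imp (fun h => ⟨s.1, h⟩) (fun h => ⟨s.1, h⟩)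

/-- Derivable sequents preserve the slash. -/
theorem LRBL.slash {Γ : FStruct α} {A : Formula α} (d : LRBL Γ A) (s : Γ.Slash) : A.Slash := by
  induction d with
  | id => exact s
  | top => exact trivial
  | bot => exact s.elim
  -- The induction hypothesis is useless here, as `A ⊙ Γ` is never slashed; the derivation itself is
  -- used, with `Γ` replaced by `⊤`.
  | impR Γ A B d _ => exact s.derivable_top (.impR _ _ _ d)
  | coimpR Γ A B d _ => exact s.derivable_top (.coimpR _ _ _ d)
  | prodR => exact s.elim
  | andR _ _ _ _ _ ih₁ ih₂ => exact ⟨ih₁ s, ih₂ s⟩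
  | orL Γ _ _ _ _ _ ih₁ ih₂ => exact (FStruct.Slash.fill_or Γ s).elim ih₁ ih₂
  | orR₁ _ _ _ _ ih => exact Or.inl (ih s)
  | orR₂ _ _ _ _ ih => exact Or.inr (ih s)
  | cut Γ _ _ _ _ _ ih₁ ih₂ => exact ih₂ (FStruct.Slash.fill_mono Γ s ih₁)
  -- The `⊙` displayed in the conclusion is not slashed, so the condition at the hole is vacuous.
  | impL Γ _ _ _ _ _ _ _ ih => exact ih (FStruct.Slash.fill_mono Γ s False.elim)
  | coimpL Γ _ _ _ _ _ _ ih _ => exact ih (FStruct.Slash.fill_mono Γ s False.elim)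
  | prodL Γ _ _ _ _ ih => exact ih (FStruct.Slash.fill_mono Γ s False.elim)
  | andL Γ _ _ _ _ ih => exact ih (FStruct.Slash.fill_mono Γ s (fun h => ⟨h.1, h.2⟩))
  | owedgeC Γ _ _ _ ih => exact ih (FStruct.Slash.fill_mono Γ s (fun h => ⟨h, h⟩))
  | odotC Γ _ _ _ _ ih => exact ih (FStruct.Slash.fill_mono Γ s False.elim)
  | owedgeE Γ _ _ _ _ ih => exact ih (FStruct.Slash.fill_mono Γ s (fun h => ⟨h.2, h.1⟩))
  | owedgeW₁ Γ _ _ _ _ ih => exact ih (FStruct.Slash.fill_mono Γ s And.right)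
  | owedgeW₂ Γ _ _ _ _ ih => exact ih (FStruct.Slash.fill_mono Γ s And.left)
  | odotW₁ Γ _ _ _ _ ih => exact ih (FStruct.Slash.fill_mono Γ s False.elim)
  | odotW₂ Γ _ _ _ _ ih => exact ih (FStruct.Slash.fill_mono Γ s False.elim)
  | owedgeA₁ Γ _ _ _ _ _ ih => exact ih (FStruct.Slash.fill_mono Γ s (fun h => ⟨⟨h.1, h.2.1⟩, h.2.2⟩))
  | owedgeA₂ Γ _ _ _ _ _ ih => exact ih (FStruct.Slash.fill_mono Γ s (fun h => ⟨h.1.1, h.1.2, h.2⟩))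

end RBL

theorem mainTheorem4 {α : Type*} (A B : RBL.Formula α)
    (h : RBL.LRBL (RBL.FStruct.of RBL.Formula.top) (RBL.Formula.or A B)) :
    RBL.LRBL (RBL.FStruct.of RBL.Formula.top) A ∨ RBL.LRBL (RBL.FStruct.of RBL.Formula.top) B := by
  have s : A.Slash ∨ B.Slash := h.slash trivial
  exact s.imp RBL.Formula.Slash.derivable RBL.Formula.Slash.derivable
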